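/- Fixed-design linear regression. Let $X\in\mathbb R^{n\times d}$, $X\neq 0$, be a deterministic design matrix with rows $x_1^\top,\dots,x_n^\top$, and let $Y=X\beta+\varepsilon$ with $\varepsilon\sim\mathcal N(0,\sigma^2 I_n)$, where $\beta\in\mathbb R^d$ and $\sigma>0$ are unknown. Put $\widehat\Sigma=n^{-1}X^\top X$ and $r=\operatorname{rank}\widehat\Sigma$, and let $\widehat\Sigma=\widehat U\widehat\Lambda^2\widehat U^\top$ be a thin eigendecomposition: $\widehat\Lambda^2=\mathrm{diag}(\widehat\lambda_1,\dots,\widehat\lambda_r)$ contains the nonzero eigenvalues in non-increasing order and $\widehat U\in\mathbb R^{d\times r}$ has orthonormal columns. Let $\theta=\widehat\Lambda\widehat U^\top\beta\in\mathbb R^r$ be the canonical coefficients. For $q\in[0,2)$ define the joint effective dimension $D^{\mathrm{eff}}_{q,r}(\widehat\Sigma,\beta)=\|\theta\|_q^q/\|\theta\|_2^q$, where $\|\theta\|_q^q=\sum_j|\theta_j|^q$ for $q>0$ and $\|\theta\|_0^0=\#\{j:\theta_j\ne0\}$. Define the signal-to-noise ratio $\mathrm{SNR}=\big(n^{-1}\sum_{i=1}^n(x_i^\top\beta)^2/\sigma^2\big)^{1/2}$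 and the error $\mathrm{MSE}(b)=n^{-1}\|Xb-X\beta\|_2^2$. For real $D$ and $S>0$ let $$\mathcal P^X(q,D,S)=\{(\beta,\sigma)\in\mathbb R^d\times(0,\infty):\ D^{\mathrm{eff}}_{q,r}(\widehat\Sigma,\beta)\le D,\ \mathrm{SNR}\ge S\},$$ $$R_X(q,D,S)=\inf_{\widetilde\beta}\ \sup_{(\beta,\sigma)\in\mathcal P^X(q,D,S)}\ \mathbb E\left[\frac{\mathrm{MSE}(\widetilde\beta)}{\mathrm{MSE}(0)}\right],$$ where the infimum is over all estimators, i.e. measurable functions $\widetilde\beta=\widetilde\beta(Y)\in\mathbb R^d$ (which may depend on the known matrix $X$). (i) There are absolute constants $D_0$ and $c>0$ such that for all $q\in(0,2)$, all $n,d$, every design matrix $X\ne0$ (and every choice of its eigendecomposition), all $D\ge D_0$ and all $S>0$, $$R_X(q,D,S)\ \ge\ c\,\min\left\{1,\ \frac1{(S^2n)^{1-q/2}},\ \frac{r}{S^2n}\right\}.$$ (ii) There is an absolute constant $c>0$ such that for all $n,d$, every design matrix $X\ne0$ (and every choice of its eigendecomposition), all $D\ge2$ and all $S>0$, $$R_X(0,D,S)\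 \ge\ c\,\min\left\{1,\ \frac{D\log(er/D)}{S^2n}\right\}.$$ -/

import Mathlib

open MeasureTheory ProbabilityTheory
open scoped ENNReal Matrix

noncomputable section

namespace CanonicalRegression

variable {n d : ℕ}

/-- The covariance matrix `n⁻¹ Xᵀ X` of the fixed design `X` (rows are the covariate vectors). -/
def sampleCov (X : Matrix (Fin n) (Fin d) ℝ) : Matrix (Fin d) (Fin d) ℝ :=
  (n : ℝ)⁻¹ • (Xᵀ * X)

/-- The rank `r` of the covariance matrix of the data. -/
def covRank (X : Matrix (Fin n) (Fin d) ℝ) : ℕ := (sampleCov X).rank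

/-- `lam` and `U` form a (thin) eigendecomposition of the covariance matrix of the data:
`lam` lists its nonzero eigenvalues in non-increasing order, and the `r` orthonormal columns
of `U` are corresponding eigenvectors. -/
structure IsEigendecomposition (X : Matrix (Fin n) (Fin d) ℝ)
    (lam : Fin (covRank X) → ℝ) (U : Matrix (Fin d) (Fin (covRank X)) ℝ) : Prop where
  pos : ∀ j, 0 < lam j
  antitone : Antitone lam
  orthonormal : Uᵀ * U = 1
  eq : sampleCov X = U * Matrix.diagonal lam * Uᵀ

/-- The canonical coefficients `θ = Λ Uᵀ β`, where `Λ = diag (√lam)`. -/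
def canonicalCoeff {r : ℕ} (lam : Fin r → ℝ) (U : Matrix (Fin d) (Fin r) ℝ)
    (β : Fin d → ℝ) : Fin r → ℝ :=
  fun j => Real.sqrt (lam j) * (Uᵀ *ᵥ β) j

open Classical in
/-- `‖a‖_q^q`, with the convention that for `q = 0` it is the number of nonzero entries. -/
def lqPow {r : ℕ} (q : ℝ) (a : Fin r → ℝ) : ℝ :=
  if q = 0 then ((Finset.univ.filter fun j => a j ≠ 0).card : ℝ) else ∑ j, |a j| ^ q

/-- The joint effective dimension `‖θ‖_q^q / ‖θ‖_2^q` of order `q` (up to index `r`). -/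
def jointEffDim {r : ℕ} (q : ℝ) (lam : Fin r → ℝ) (U : Matrix (Fin d) (Fin r) ℝ)
    (β : Fin d → ℝ) : ℝ :=
  lqPow q (canonicalCoeff lam U β) / Real.sqrt (∑ j, canonicalCoeff lam U β j ^ 2) ^ q

/-- The mean squared error `n⁻¹ ‖X b - X β‖²` of `b` when the true coefficient vector is `β`. -/
def mse (X : Matrix (Fin n) (Fin d) ℝ) (β b : Fin d → ℝ) : ℝ :=
  (n : ℝ)⁻¹ * ∑ i, ((X *ᵥ b) i - (X *ᵥ β) i) ^ 2

/-- The signal-to-noise ratio `(n⁻¹ ∑ᵢ (xᵢᵀ β)² / σ²)^{1/2}`. -/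
def snr (X : Matrix (Fin n) (Fin d) ℝ) (β : Fin d → ℝ) (σ : ℝ) : ℝ :=
  Real.sqrt (((n : ℝ)⁻¹ * ∑ i, (X *ᵥ β) i ^ 2) / σ ^ 2)

/-- The class of parameters `(β, σ)`, `σ > 0`, whose joint effective dimension of order `q` is
at most `D` and whose signal-to-noise ratio is at least `S`. -/
def paramClass (X : Matrix (Fin n) (Fin d) ℝ) (lam : Fin (covRank X) → ℝ)
    (U : Matrix (Fin d) (Fin (covRank X)) ℝ) (q D S : ℝ) : Set ((Fin d → ℝ) × ℝ) :=
  {p | 0 < p.2 ∧ jointEffDim q lam U p.1 ≤ D ∧ S ≤ snr X p.1 p.2}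

/-- The law of `Y = X β + ε` with `ε ~ N(0, σ² Iₙ)`. -/
def obsLaw (X : Matrix (Fin n) (Fin d) ℝ) (β : Fin d → ℝ) (σ : ℝ) : Measure (Fin n → ℝ) :=
  Measure.pi fun i => gaussianReal ((X *ᵥ β) i) (σ ^ 2).toNNReal

/-- The expected relative error `E [MSE(b) / MSE(0)]` of an estimator `b = b(Y)`. -/
def expRelMSE (X : Matrix (Fin n) (Fin d) ℝ) (b : (Fin n → ℝ) → (Fin d → ℝ))
    (β : Fin d → ℝ) (σ : ℝ) : ℝ≥0∞ :=
  ∫⁻ y, ENNReal.ofReal (mse X β (b y) / mse X β 0) ∂(obsLaw X β σ)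

/-- The minimax expected relative error: the infimum over all (measurable) estimators of the
supremum over the parameter class. -/
def minimaxRelMSE (X : Matrix (Fin n) (Fin d) ℝ) (lam : Fin (covRank X) → ℝ)
    (U : Matrix (Fin d) (Fin (covRank X)) ℝ) (q D S : ℝ) : ℝ≥0∞ :=
  ⨅ (b : (Fin n → ℝ) → (Fin d → ℝ)) (_ : Measurable b),
    ⨆ p ∈ paramClass X lam U q D S, expRelMSE X b p.1 p.2

end CanonicalRegression

end

/-!
In the canonical coordinates the relative error is `‖θ̃ - θ‖² / ‖θ‖²` and the signal-to-noise ratio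
is `‖θ‖ / σ` (`IsEigendecomposition.mse_eq`, `IsEigendecomposition.snr_eq`), so the observations
carry noise of level `σ / √n` in each of the `r` coordinates. The lower bound is Bayesian. Split
coordinates into `m` blocks of length `B`, and let `θ` be a vector of the standard basis plus, in
each block independently, either nothing or a spike of height `a` at one of the `B` positions, the
`B + 1` options being equally likely (`spikedCoeff`). If `m a² ≤ 1`, then `1 ≤ ‖θ‖² ≤ 4`. The fixed
unit coefficient bounds the signal-to-noise ratio from below while the spikes change the signal;
this also covers `r = 1`.

The estimator misses the truth by `a / 2` on a block unless it identifies the option used there.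
With `N = B + 1` options the acceptance regions are disjoint, and the mean of each Gaussian law
involved is at distance at most `√n a` from the mean of the law with an empty block. The density
with mean `u` is `exp (‖u - w‖² / (2 σ²))` times the geometric mean of the densities with means `w`
and `2 u - w`. By the inequality of the means, the probabilities of a correct identification add up
to at most `√N exp (n a² / (2 σ²))` (`sum_pi_gaussianReal_real_le`). This is at most `7 N / 8` if `n
a² ≤ σ² log N / 2`, so no Fano-type inequality is needed. Averaging over the other blocks
(`sum_sum_update_eq`) and summing over the blocks, some parameter has relative error at least `m a²
/ 128` (`IsEigendecomposition.le_minimaxRelMSE`).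

For `0 < q < 2` one takes `B = 1`, `a` of the order of the noise level, and `m` as large as the rank
and the `ℓ_q` constraint permit. For `q = 0` one takes `m = ⌊D⌋ - 1` (at most `r`), `B = ⌊r / m⌋`,
and `a²` the smaller of `1 / m` and a multiple of the squared noise level times `log (B + 1)`.
-/

namespace CanonicalRegression

open scoped NNReal

/-! ### Comparison of Gaussian laws -/

theorem pi_gaussianReal_eq_withDensity {ι : Type*} [Fintype ι] (u : ι → ℝ) {v : ℝ≥0}
    (hv : v ≠ 0) :
    Measure.pi (fun i => gaussianReal (u i) v)
      = volume.withDensity (fun y : ι → ℝ =>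
          ENNReal.ofReal (∏ i, gaussianPDFReal (u i) v (y i))) := by
  refine Measure.pi_eq fun s hs => ?_
  rw [withDensity_apply _ (MeasurableSet.univ_pi hs), volume_pi, Measure.restrict_pi_pi,
    ← ofReal_integral_eq_lintegral_ofReal]
  · rw [integral_fintype_prod_eq_prod (fun i x => gaussianPDFReal (u i) v x),
      ENNReal.ofReal_prod_of_nonneg]
    · simp_rw [gaussianReal_apply_eq_integral _ hv]
    · exact fun i _ => integral_nonneg fun x => gaussianPDFReal_nonneg _ _ _
  · exact Integrable.fintype_prod_dep fun i => (integrable_gaussianPDFReal (u i) v).restrict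
  · exact ae_of_all _ fun y => Finset.prod_nonneg fun i _ => gaussianPDFReal_nonneg _ _ _

theorem integrable_prod_gaussianPDFReal {ι : Type*} [Fintype ι] (u : ι → ℝ) (v : ℝ≥0) :
    Integrable (fun y : ι → ℝ => ∏ i, gaussianPDFReal (u i) v (y i)) :=
  Integrable.fintype_prod_dep fun i => integrable_gaussianPDFReal (u i) v

theorem pi_gaussianReal_real_apply {ι : Type*} [Fintype ι] (u : ι → ℝ) {v : ℝ≥0}
    (hv : v ≠ 0) {A : Set (ι → ℝ)} (hA : MeasurableSet A) :
    (Measure.pi (fun i => gaussianReal (u i) v)).real A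
      = ∫ y in A, ∏ i, gaussianPDFReal (u i) v (y i) := by
  have h0 : ∀ y : ι → ℝ, 0 ≤ ∏ i, gaussianPDFReal (u i) v (y i) :=
    fun y => Finset.prod_nonneg fun i _ => gaussianPDFReal_nonneg _ _ _
  rw [Measure.real, pi_gaussianReal_eq_withDensity u hv, withDensity_apply _ hA,
    ← ofReal_integral_eq_lintegral_ofReal (integrable_prod_gaussianPDFReal u v).restrict
      (ae_of_all _ h0), ENNReal.toReal_ofReal (integral_nonneg h0)]

/-- The density with mean `u` is, up to a constant, the geometric mean of the densities with means
`w` and `2 u - w`, because `u` is the midpoint of the two. -/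
theorem gaussianPDFReal_sq_eq (u w x : ℝ) {v : ℝ≥0} (hv : v ≠ 0) :
    gaussianPDFReal u v x ^ 2
      = Real.exp ((u - w) ^ 2 / v) * (gaussianPDFReal w v x * gaussianPDFReal (2 * u - w) v x) := by
  have hv' : (v : ℝ) ≠ 0 := by exact_mod_cast hv
  have h : Real.exp (-(x - u) ^ 2 / (2 * v)) ^ 2 = Real.exp ((u - w) ^ 2 / v)
      * (Real.exp (-(x - w) ^ 2 / (2 * v)) * Real.exp (-(x - (2 * u - w)) ^ 2 / (2 * v))) := by
    rw [← Real.exp_add, ← Real.exp_add, ← Real.exp_nat_mul]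
    congr 1
    push_cast
    field_simp
    ring
  simp only [gaussianPDFReal, mul_pow, h]
  ring

/-- A comparison of two Gaussian laws with the same covariance `v I`, which integrates the
inequality of the geometric and the arithmetic mean with weights `l` and `l⁻¹`. -/
theorem pi_gaussianReal_real_le {ι : Type*} [Fintype ι] (u w : ι → ℝ) {v : ℝ≥0}
    (hv : v ≠ 0) {A : Set (ι → ℝ)} (hA : MeasurableSet A) {l : ℝ} (hl : 0 < l) :
    (Measure.pi (fun i => gaussianReal (u i) v)).real A
      ≤ Real.exp ((∑ i, (u i - w i) ^ 2) / (2 * v)) / 2 *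
        (l * (Measure.pi (fun i => gaussianReal (w i) v)).real A + l⁻¹) := by
  set E := Real.exp ((∑ i, (u i - w i) ^ 2) / (2 * v)) with hE
  have hE0 : 0 < E := Real.exp_pos _
  have hE2 : E ^ 2 = ∏ i, Real.exp ((u i - w i) ^ 2 / v) := by
    rw [← Real.exp_sum, hE, ← Real.exp_nat_mul, ← Finset.sum_div]
    congr 1
    push_cast
    field_simp
  have key : ∀ y : ι → ℝ, ∏ i, gaussianPDFReal (u i) v (y i)
      ≤ E / 2 * (l * ∏ i, gaussianPDFReal (w i) v (y i)
        + l⁻¹ * ∏ i, gaussianPDFReal (2 * u i - w i) v (y i)) := by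
    intro y
    set p := ∏ i, gaussianPDFReal (w i) v (y i) with hp
    set q := ∏ i, gaussianPDFReal (2 * u i - w i) v (y i) with hq
    have hp0 : 0 ≤ p := Finset.prod_nonneg fun i _ => gaussianPDFReal_nonneg _ _ _
    have hq0 : 0 ≤ q := Finset.prod_nonneg fun i _ => gaussianPDFReal_nonneg _ _ _
    have hsq : (∏ i, gaussianPDFReal (u i) v (y i)) ^ 2 = E ^ 2 * (p * q) := by
      rw [← Finset.prod_pow, hE2, hp, hq, ← Finset.prod_mul_distrib, ← Finset.prod_mul_distrib]
      exact Finset.prod_congr rfl fun i _ => gaussianPDFReal_sq_eq _ _ _ hv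
    refine (sq_le_sq₀ (Finset.prod_nonneg fun i _ => gaussianPDFReal_nonneg _ _ _)
      (by positivity)).1 ?_
    rw [hsq]
    have h1 : l * l⁻¹ = 1 := mul_inv_cancel₀ hl.ne'
    have h2 : (E / 2 * (l * p + l⁻¹ * q)) ^ 2
        = E ^ 2 * ((l * p - l⁻¹ * q) ^ 2 / 4 + (l * l⁻¹) * (p * q)) := by ring
    rw [h2, h1]
    refine mul_le_mul_of_nonneg_left ?_ (sq_nonneg E)
    nlinarith [sq_nonneg (l * p - l⁻¹ * q)]
  have hiw := (integrable_prod_gaussianPDFReal w v).restrict (s := A)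
  have hiz := (integrable_prod_gaussianPDFReal (fun i => 2 * u i - w i) v).restrict (s := A)
  have hz := pi_gaussianReal_real_apply (fun i => 2 * u i - w i) hv hA
  rw [pi_gaussianReal_real_apply u hv hA, pi_gaussianReal_real_apply w hv hA]
  calc ∫ y in A, ∏ i, gaussianPDFReal (u i) v (y i)
      ≤ ∫ y in A, E / 2 * (l * ∏ i, gaussianPDFReal (w i) v (y i)
        + l⁻¹ * ∏ i, gaussianPDFReal (2 * u i - w i) v (y i)) :=
        integral_mono (integrable_prod_gaussianPDFReal u v).restrict
          (((hiw.const_mul l).add (hiz.const_mul l⁻¹)).const_mul _) key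
    _ = E / 2 * (l * (∫ y in A, ∏ i, gaussianPDFReal (w i) v (y i))
        + l⁻¹ * ∫ y in A, ∏ i, gaussianPDFReal (2 * u i - w i) v (y i)) := by
        rw [integral_const_mul, integral_add (hiw.const_mul l) (hiz.const_mul l⁻¹),
          integral_const_mul, integral_const_mul]
    _ ≤ _ := by
        refine mul_le_mul_of_nonneg_left ?_ (by positivity)
        rw [← hz]
        have := mul_le_of_le_one_right (inv_nonneg.2 hl.le) (measureReal_le_one
          (μ := Measure.pi fun i => gaussianReal (2 * u i - w i) v) (s := A))
        linarith

/-- Testing among `N` Gaussian means at squared distance at most `δ` from a common reference `w`: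
with the weight `√N` in `pi_gaussianReal_real_le`, the probabilities of pairwise disjoint
acceptance regions add up to at most `√N exp (δ / (2 v))`. -/
theorem sum_pi_gaussianReal_real_le {ι κ : Type*} [Fintype ι] [Fintype κ] [Nonempty κ]
    (u : κ → ι → ℝ) (w : ι → ℝ) {v : ℝ≥0} (hv : v ≠ 0) {A : κ → Set (ι → ℝ)}
    (hA : ∀ j, MeasurableSet (A j)) (hdisj : Pairwise (Function.onFun Disjoint A)) {δ : ℝ}
    (hδ : ∀ j, ∑ i, (u j i - w i) ^ 2 ≤ δ) :
    ∑ j, (Measure.pi (fun i => gaussianReal (u j i) v)).real (A j)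
      ≤ Real.sqrt (Fintype.card κ) * Real.exp (δ / (2 * v)) := by
  set N : ℝ := (Fintype.card κ : ℝ) with hN
  have hN0 : 0 < N := by rw [hN]; exact_mod_cast Fintype.card_pos
  have hs : 0 < Real.sqrt N := Real.sqrt_pos.2 hN0
  set P := Measure.pi (fun i => gaussianReal (w i) v) with hP
  have hsum : ∑ j, P.real (A j) ≤ 1 := by
    rw [← measureReal_iUnion_fintype hdisj hA]
    exact measureReal_le_one
  have hsub : ∀ j, (Measure.pi (fun i => gaussianReal (u j i) v)).real (A j)
      ≤ Real.exp (δ / (2 * v)) / 2 * (Real.sqrt N * P.real (A j) + (Real.sqrt N)⁻¹) := by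
    intro j
    refine (pi_gaussianReal_real_le (u j) w hv (hA j) hs).trans ?_
    have := hδ j
    gcongr
  calc _ ≤ ∑ j, Real.exp (δ / (2 * v)) / 2 * (Real.sqrt N * P.real (A j) + (Real.sqrt N)⁻¹) :=
        Finset.sum_le_sum fun j _ => hsub j
    _ = Real.exp (δ / (2 * v)) / 2 * (Real.sqrt N * ∑ j, P.real (A j) + N * (Real.sqrt N)⁻¹) := by
        rw [← Finset.mul_sum, Finset.sum_add_distrib, ← Finset.mul_sum]
        simp [hN]
    _ ≤ Real.exp (δ / (2 * v)) / 2 * (Real.sqrt N * 1 + Real.sqrt N) := by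
        have : N * (Real.sqrt N)⁻¹ = Real.sqrt N := by
          rw [← div_eq_mul_inv, Real.div_sqrt]
        rw [this]
        gcongr
    _ = _ := by ring

/-! ### Prediction error in canonical coordinates -/

theorem pos_of_design_ne_zero {n d : ℕ} {X : Matrix (Fin n) (Fin d) ℝ} (hX : X ≠ 0) : 0 < n := by
  rcases Nat.eq_zero_or_pos n with rfl | h
  · exact absurd (Subsingleton.elim X 0) hX
  · exact h

theorem covRank_pos {n d : ℕ} {X : Matrix (Fin n) (Fin d) ℝ} (hX : X ≠ 0) : 0 < covRank X := by
  have hn := pos_of_design_ne_zero hX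
  refine Nat.pos_of_ne_zero fun h => hX ?_
  have h0 : sampleCov X = 0 := by
    rw [covRank, Matrix.rank, Module.finrank_eq_zero_iff_of_free] at h
    have h1 : LinearMap.range (sampleCov X).mulVecLin = ⊥ :=
      Submodule.eq_bot_of_subsingleton
    rw [LinearMap.range_eq_bot] at h1
    ext i j
    have := congrFun (congrArg (fun f => f (Pi.single j 1)) h1) i
    simpa using this
  rw [sampleCov, smul_eq_zero] at h0
  rcases h0 with h0 | h0
  · simp [hn.ne'] at h0
  · rwa [← Matrix.conjTranspose_eq_transpose_of_trivial,
      Matrix.conjTranspose_mul_self_eq_zero] at h0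

section

variable {n d : ℕ} {X : Matrix (Fin n) (Fin d) ℝ} {lam : Fin (covRank X) → ℝ}
  {U : Matrix (Fin d) (Fin (covRank X)) ℝ}

/-- The prediction norm of the design is the Euclidean norm of the canonical coefficients. -/
theorem IsEigendecomposition.sum_mulVec_sq (h : IsEigendecomposition X lam U) (w : Fin d → ℝ) :
    (n : ℝ)⁻¹ * ∑ i, (X *ᵥ w) i ^ 2 = ∑ j, canonicalCoeff lam U w j ^ 2 := by
  have h1 : (n : ℝ)⁻¹ * ∑ i, (X *ᵥ w) i ^ 2 = w ⬝ᵥ (sampleCov X *ᵥ w) := by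
    rw [sampleCov, Matrix.smul_mulVec, dotProduct_smul, ← Matrix.mulVec_mulVec,
      Matrix.dotProduct_mulVec, Matrix.vecMul_transpose, smul_eq_mul]
    simp [dotProduct, sq]
  rw [h1, h.eq, ← Matrix.mulVec_mulVec, ← Matrix.mulVec_mulVec, Matrix.dotProduct_mulVec,
    ← Matrix.mulVec_transpose]
  simp only [dotProduct, Matrix.mulVec_diagonal, canonicalCoeff, mul_pow]
  refine Finset.sum_congr rfl fun j _ => ?_
  rw [Real.sq_sqrt (h.pos j).le]
  ring

theorem canonicalCoeff_sub {r : ℕ} (l : Fin r → ℝ) (V : Matrix (Fin d) (Fin r) ℝ)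
    (b β : Fin d → ℝ) (j : Fin r) :
    canonicalCoeff l V (b - β) j = canonicalCoeff l V b j - canonicalCoeff l V β j := by
  simp [canonicalCoeff, Matrix.mulVec_sub, mul_sub]

theorem IsEigendecomposition.mse_eq (h : IsEigendecomposition X lam U) (β b : Fin d → ℝ) :
    mse X β b = ∑ j, (canonicalCoeff lam U b j - canonicalCoeff lam U β j) ^ 2 := by
  simp_rw [← canonicalCoeff_sub, ← h.sum_mulVec_sq, mse, Matrix.mulVec_sub, Pi.sub_apply]

theorem IsEigendecomposition.mse_zero (h : IsEigendecomposition X lam U) (β : Fin d → ℝ) :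
    mse X β 0 = ∑ j, canonicalCoeff lam U β j ^ 2 := by
  rw [h.mse_eq]
  simp [canonicalCoeff]

theorem IsEigendecomposition.snr_eq (h : IsEigendecomposition X lam U) (β : Fin d → ℝ) (σ : ℝ) :
    snr X β σ = Real.sqrt ((∑ j, canonicalCoeff lam U β j ^ 2) / σ ^ 2) := by
  rw [snr, h.sum_mulVec_sq]

theorem IsEigendecomposition.exists_canonicalCoeff_eq (h : IsEigendecomposition X lam U)
    (θ : Fin (covRank X) → ℝ) : ∃ β : Fin d → ℝ, canonicalCoeff lam U β = θ := by
  refine ⟨U *ᵥ fun j => θ j / Real.sqrt (lam j), ?_⟩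
  ext j
  have := (Real.sqrt_pos.2 (h.pos j)).ne'
  rw [canonicalCoeff, Matrix.mulVec_mulVec, h.orthonormal, Matrix.one_mulVec]
  field_simp

theorem measurable_canonicalCoeff {r : ℕ} (l : Fin r → ℝ) (V : Matrix (Fin d) (Fin r) ℝ)
    (j : Fin r) : Measurable fun b : Fin d → ℝ => canonicalCoeff l V b j := by
  simp only [canonicalCoeff, Matrix.mulVec, dotProduct]
  fun_prop

end

/-! ### Hypotheses with one spike at most in each block -/

open Classical in
/-- The indicator of the coordinates `e (b, j)` that the choice `ω` selects: in the block `b` it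
selects the position `j` if `ω b = some j`, and no position if `ω b = none`. -/
noncomputable def spikes {κ π ι : Type*} (e : κ × π ↪ ι) (ω : κ → Option π) (i : ι) : ℝ :=
  if ∃ p : κ × π, e p = i ∧ ω p.1 = some p.2 then 1 else 0

open Classical in
/-- The canonical coefficients of the hypotheses: a unit coefficient at `i₀`, to which a
coefficient `a` is added at one position at most in each block. -/
noncomputable def spikedCoeff {κ π ι : Type*} (a : ℝ) (i₀ : ι) (e : κ × π ↪ ι) (ω : κ → Option π)
    (i : ι) : ℝ :=
  (if i = i₀ then 1 else 0) + a * spikes e ω i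

section spikes

variable {κ π ι : Type*} (e : κ × π ↪ ι) (ω : κ → Option π)

open Classical in
theorem spikes_apply (p : κ × π) : spikes e ω (e p) = if ω p.1 = some p.2 then 1 else 0 := by
  simp [spikes]

theorem spikes_of_notMem_range {i : ι} (hi : i ∉ Set.range e) : spikes e ω i = 0 := by
  rw [spikes, if_neg]
  rintro ⟨p, hp, -⟩
  exact hi ⟨p, hp⟩

theorem spikes_eq_zero_or_one (i : ι) : spikes e ω i = 0 ∨ spikes e ω i = 1 := by
  unfold spikes
  split_ifs <;> simp

theorem spikes_nonneg (i : ι) : 0 ≤ spikes e ω i := by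
  rcases spikes_eq_zero_or_one e ω i with h | h <;> simp [h]

theorem sum_spikes_le [Fintype κ] [Fintype π] [Fintype ι] :
    ∑ i, spikes e ω i ≤ Fintype.card κ := by
  classical
  rw [← Fintype.sum_of_injective e e.injective (fun p => spikes e ω (e p)) (spikes e ω)
    (fun i hi => spikes_of_notMem_range e ω hi) (fun _ => rfl), Fintype.sum_prod_type]
  calc ∑ b, ∑ j, spikes e ω (e (b, j)) ≤ ∑ _b : κ, (1 : ℝ) := by
        refine Finset.sum_le_sum fun b _ => ?_
        have hc : ∀ c : Option π, ∑ j, (if c = some j then (1 : ℝ) else 0) ≤ 1 := by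
          intro c
          cases c <;> simp
        simp only [spikes_apply]
        convert hc (ω b)
    _ = Fintype.card κ := by simp

theorem one_le_sum_spikedCoeff_sq [Fintype ι] {a : ℝ} (ha : 0 ≤ a) (i₀ : ι) :
    1 ≤ ∑ i, spikedCoeff a i₀ e ω i ^ 2 := by
  have h1 : 1 ≤ spikedCoeff a i₀ e ω i₀ := by
    have := mul_nonneg ha (spikes_nonneg e ω i₀)
    simp only [spikedCoeff, if_true]
    linarith
  calc (1 : ℝ) ≤ spikedCoeff a i₀ e ω i₀ ^ 2 := one_le_pow₀ h1
    _ ≤ _ := Finset.single_le_sum (f := fun i => spikedCoeff a i₀ e ω i ^ 2)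
        (fun i _ => sq_nonneg _) (Finset.mem_univ i₀)

theorem sum_spikedCoeff_sq_le [Fintype κ] [Fintype π] [Fintype ι] {a : ℝ} (i₀ : ι)
    (hma : Fintype.card κ * a ^ 2 ≤ 1) : ∑ i, spikedCoeff a i₀ e ω i ^ 2 ≤ 4 := by
  classical
  calc ∑ i, spikedCoeff a i₀ e ω i ^ 2
      ≤ ∑ i, (2 * (if i = i₀ then 1 else 0) + 2 * a ^ 2 * spikes e ω i) := by
        refine Finset.sum_le_sum fun i _ => ?_
        rcases spikes_eq_zero_or_one e ω i with h | h <;> simp only [spikedCoeff, h] <;>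
          split_ifs <;> nlinarith [sq_nonneg (a - 1), sq_nonneg a]
    _ = 2 + 2 * a ^ 2 * ∑ i, spikes e ω i := by
        rw [Finset.sum_add_distrib, ← Finset.mul_sum, ← Finset.mul_sum]
        simp
    _ ≤ 2 + 2 * a ^ 2 * Fintype.card κ := by
        gcongr
        exact sum_spikes_le e ω
    _ ≤ 4 := by linarith

/-- Changing the selection in one block to the empty one moves the coefficients by `a` at most. -/
theorem sum_spikedCoeff_sub_sq_le [Fintype π] [Fintype ι] [DecidableEq κ] (a : ℝ) (i₀ : ι) (b : κ)
    (c : Option π) :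
    ∑ i, (spikedCoeff a i₀ e (Function.update ω b c) i
      - spikedCoeff a i₀ e (Function.update ω b none) i) ^ 2 ≤ a ^ 2 := by
  classical
  have hdiff : ∀ i, spikedCoeff a i₀ e (Function.update ω b c) i
      - spikedCoeff a i₀ e (Function.update ω b none) i
      = a * (spikes e (Function.update ω b c) i - spikes e (Function.update ω b none) i) := by
    intro i
    simp only [spikedCoeff]
    ring
  simp only [hdiff, mul_pow, ← Finset.mul_sum]
  refine mul_le_of_le_one_right (sq_nonneg a) ?_
  have hinj : Function.Injective fun j => e (b, j) := fun j k h => by simpa using h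
  rw [← Fintype.sum_of_injective (fun j => e (b, j)) hinj
    (fun j => (if c = some j then (1 : ℝ) else 0)) _ ?_ ?_]
  · cases c <;> simp
  · intro i hi
    by_cases hr : i ∈ Set.range e
    · obtain ⟨⟨b', j⟩, rfl⟩ := hr
      have hb : b' ≠ b := by
        rintro rfl
        exact hi ⟨j, rfl⟩
      simp [spikes_apply, hb]
    · simp [spikes_of_notMem_range _ _ hr]
  · intro j
    simp [spikes_apply]

/-- Different selections in one block give coefficients that differ there by `a` at least. -/
theorem le_sum_spikedCoeff_sub_sq [Fintype π] [DecidableEq κ] (a : ℝ) (i₀ : ι) (b : κ)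
    {c c' : Option π} (hc : c ≠ c') :
    a ^ 2 ≤ ∑ j, (spikedCoeff a i₀ e (Function.update ω b c) (e (b, j))
      - spikedCoeff a i₀ e (Function.update ω b c') (e (b, j))) ^ 2 := by
  classical
  have hdiff : ∀ j, spikedCoeff a i₀ e (Function.update ω b c) (e (b, j))
      - spikedCoeff a i₀ e (Function.update ω b c') (e (b, j))
      = a * ((if c = some j then 1 else 0) - (if c' = some j then 1 else 0)) := by
    intro j
    simp only [spikedCoeff, spikes_apply, Function.update_self]
    ring
  simp only [hdiff, mul_pow, ← Finset.mul_sum]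
  refine le_mul_of_one_le_right (sq_nonneg a) ?_
  obtain ⟨k, hk⟩ : ∃ k, (c = some k ∧ c' ≠ some k) ∨ (c ≠ some k ∧ c' = some k) := by
    cases c with
    | none =>
      cases c' with
      | none => exact absurd rfl hc
      | some k => exact ⟨k, Or.inr ⟨by simp, rfl⟩⟩
    | some k => exact ⟨k, Or.inl ⟨rfl, fun h => hc h.symm⟩⟩
  refine le_trans ?_ (Finset.single_le_sum (f := fun j =>
    ((if c = some j then (1 : ℝ) else 0) - (if c' = some j then 1 else 0)) ^ 2)
    (fun j _ => sq_nonneg _) (Finset.mem_univ k))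
  rcases hk with ⟨h1, h2⟩ | ⟨h1, h2⟩ <;> simp [h1, h2]

end spikes

theorem lqPow_zero_spikedCoeff_le {r : ℕ} {κ π : Type*} [Fintype κ] [Fintype π]
    (e : κ × π ↪ Fin r) (ω : κ → Option π) (a : ℝ) (i₀ : Fin r) :
    lqPow 0 (spikedCoeff a i₀ e ω) ≤ 1 + Fintype.card κ := by
  classical
  rw [lqPow, if_pos rfl, Finset.card_filter, Nat.cast_sum]
  calc ∑ i, ((if spikedCoeff a i₀ e ω i ≠ 0 then 1 else 0 : ℕ) : ℝ)
      ≤ ∑ i, ((if i = i₀ then 1 else 0) + spikes e ω i) := by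
        refine Finset.sum_le_sum fun i _ => ?_
        rcases spikes_eq_zero_or_one e ω i with h | h <;> simp only [spikedCoeff, h] <;>
          split_ifs <;> simp_all
    _ ≤ 1 + Fintype.card κ := by
        rw [Finset.sum_add_distrib]
        simpa using sum_spikes_le e ω

theorem lqPow_spikedCoeff_le {r : ℕ} {κ π : Type*} [Fintype κ] [Fintype π]
    (e : κ × π ↪ Fin r) (ω : κ → Option π) {a : ℝ} (ha : 0 ≤ a) (ha1 : a ≤ 1) (i₀ : Fin r) {q : ℝ}
    (hq : 0 < q) (hq2 : q ≤ 2) :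
    lqPow q (spikedCoeff a i₀ e ω) ≤ 4 + Fintype.card κ * a ^ q := by
  classical
  have haq : 0 ≤ a ^ q := Real.rpow_nonneg ha q
  rw [lqPow, if_neg hq.ne']
  calc ∑ i, |spikedCoeff a i₀ e ω i| ^ q
      ≤ ∑ i, (4 * (if i = i₀ then 1 else 0) + spikes e ω i * a ^ q) := by
        refine Finset.sum_le_sum fun i _ => ?_
        have hs := spikes_eq_zero_or_one e ω i
        by_cases hi : i = i₀
        · have h0 : 0 ≤ a * spikes e ω i := mul_nonneg ha (spikes_nonneg e ω i)
          have h2 : 1 + a * spikes e ω i ≤ 2 := by rcases hs with h | h <;> rw [h] <;> linarith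
          have h4 : |spikedCoeff a i₀ e ω i| ^ q ≤ 4 := by
            rw [spikedCoeff, if_pos hi, abs_of_nonneg (by linarith)]
            calc (1 + a * spikes e ω i) ^ q ≤ 2 ^ q := Real.rpow_le_rpow (by linarith) h2 hq.le
              _ ≤ 2 ^ (2 : ℝ) := Real.rpow_le_rpow_of_exponent_le one_le_two hq2
              _ = 4 := by norm_num
          have := mul_nonneg (spikes_nonneg e ω i) haq
          rw [if_pos hi]
          linarith
        · rcases hs with h | h
          · simp [spikedCoeff, h, hi, Real.zero_rpow hq.ne']
          · simp [spikedCoeff, h, hi, abs_of_nonneg ha]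
    _ = 4 + (∑ i, spikes e ω i) * a ^ q := by
        rw [Finset.sum_add_distrib, ← Finset.mul_sum, ← Finset.sum_mul]
        simp
    _ ≤ _ := by
        gcongr
        exact sum_spikes_le e ω

/-! ### The minimax bound for spiked coefficients -/

/-- Averaging over all `ω` is the same as averaging over all `ω` and over all values at `b`. -/
theorem sum_sum_update_eq {κ α : Type*} [Fintype κ] [DecidableEq κ] [Fintype α]
    (b : κ) (F : (κ → α) → ℝ) :
    ∑ ω, ∑ c, F (Function.update ω b c) = Fintype.card α * ∑ ω, F ω := by
  -- `(ω, c) ↦ (update ω b c, ω b)` is an involution.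
  let f : (κ → α) × α ≃ (κ → α) × α := Function.Involutive.toPerm
    (fun p => (Function.update p.1 b p.2, p.1 b)) (fun p => by simp)
  rw [← Fintype.sum_prod_type' (fun ω c => F (Function.update ω b c))]
  calc ∑ p : (κ → α) × α, F (Function.update p.1 b p.2)
      = ∑ p : (κ → α) × α, F (f p).1 := rfl
    _ = ∑ p : (κ → α) × α, F p.1 := Equiv.sum_comp f fun p => F p.1
    _ = _ := by
      rw [Fintype.sum_prod_type]
      simp [Finset.mul_sum]

theorem sqrt_mul_exp_log_div_four_le {N : ℝ} (hN : 2 ≤ N) :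
    Real.sqrt N * Real.exp (Real.log N / 4) ≤ 7 / 8 * N := by
  set x := Real.exp (Real.log N / 4) with hx
  have hx0 : 0 < x := Real.exp_pos _
  have h4 : x ^ 4 = N := by
    rw [hx, ← Real.exp_nat_mul]
    push_cast
    rw [mul_div_cancel₀ _ (by norm_num), Real.exp_log (by linarith)]
  have hs : Real.sqrt N = x ^ 2 := by
    rw [← h4, show x ^ 4 = (x ^ 2) ^ 2 by ring, Real.sqrt_sq (by positivity)]
  have h8 : 8 / 7 ≤ x := by
    refine le_of_pow_le_pow_left₀ (n := 4) (by norm_num) hx0.le ?_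
    rw [h4]
    norm_num
    linarith
  rw [hs, ← h4]
  nlinarith [pow_pos hx0 3]

section

variable {n d : ℕ} {X : Matrix (Fin n) (Fin d) ℝ} {lam : Fin (covRank X) → ℝ}
  {U : Matrix (Fin d) (Fin (covRank X)) ℝ}

instance (X : Matrix (Fin n) (Fin d) ℝ) (β : Fin d → ℝ) (σ : ℝ) :
    IsProbabilityMeasure (obsLaw X β σ) := by
  unfold obsLaw
  infer_instance

/-- The observations for which the estimator `t` of the canonical coefficients is within `a / 2`
of `θ` on the block `b`. -/
def nearSet {κ π ι Ω : Type*} [Fintype π] (e : κ × π ↪ ι) (a : ℝ) (t : Ω → ι → ℝ) (θ : ι → ℝ)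
    (b : κ) : Set Ω :=
  {y | ∑ j, (t y (e (b, j)) - θ (e (b, j))) ^ 2 < a ^ 2 / 4}

theorem measurableSet_nearSet {κ π ι Ω : Type*} [Fintype π] [MeasurableSpace Ω] (e : κ × π ↪ ι)
    (a : ℝ) {t : Ω → ι → ℝ} (ht : ∀ i, Measurable fun y => t y i) (θ : ι → ℝ) (b : κ) :
    MeasurableSet (nearSet e a t θ b) := by
  refine measurableSet_lt ?_ measurable_const
  exact Finset.measurable_sum _ fun j _ => ((ht _).sub_const _).pow_const 2

theorem disjoint_nearSet {κ π ι Ω : Type*} [Fintype π] (e : κ × π ↪ ι) (a : ℝ) (t : Ω → ι → ℝ)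
    {θ θ' : ι → ℝ} (b : κ)
    (h : a ^ 2 ≤ ∑ j, (θ (e (b, j)) - θ' (e (b, j))) ^ 2) :
    Disjoint (nearSet e a t θ b) (nearSet e a t θ' b) := by
  rw [Set.disjoint_left]
  intro y hy hy'
  simp only [nearSet, Set.mem_ofPred_eq] at hy hy'
  have : ∑ j, (θ (e (b, j)) - θ' (e (b, j))) ^ 2
      ≤ 2 * ∑ j, (t y (e (b, j)) - θ (e (b, j))) ^ 2
        + 2 * ∑ j, (t y (e (b, j)) - θ' (e (b, j))) ^ 2 := by
    rw [Finset.mul_sum, Finset.mul_sum, ← Finset.sum_add_distrib]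
    refine Finset.sum_le_sum fun j _ => ?_
    nlinarith [sq_nonneg ((t y (e (b, j)) - θ (e (b, j))) + (t y (e (b, j)) - θ' (e (b, j))))]
  linarith

/-- An estimator pays at least `a² / 4` on every block where it is not within `a / 2`. -/
theorem sum_indicator_compl_nearSet_le {κ π ι Ω : Type*} [Fintype κ] [Fintype π] [Fintype ι]
    (e : κ × π ↪ ι) (a : ℝ) (t : Ω → ι → ℝ) (θ : ι → ℝ) (y : Ω) :
    ∑ b, (nearSet e a t θ b)ᶜ.indicator (fun _ => a ^ 2 / 4) y ≤ ∑ i, (t y i - θ i) ^ 2 := by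
  classical
  calc ∑ b, (nearSet e a t θ b)ᶜ.indicator (fun _ => a ^ 2 / 4) y
      ≤ ∑ b, ∑ j, (t y (e (b, j)) - θ (e (b, j))) ^ 2 := by
        refine Finset.sum_le_sum fun b _ => Set.indicator_apply_le' (fun h => ?_) fun _ => ?_
        · simpa [nearSet] using h
        · exact Finset.sum_nonneg fun j _ => sq_nonneg _
    _ = ∑ p, (t y (e p) - θ (e p)) ^ 2 := by rw [Fintype.sum_prod_type]
    _ = ∑ i ∈ Finset.univ.map e, (t y i - θ i) ^ 2 := by rw [Finset.sum_map]
    _ ≤ _ := Finset.sum_le_sum_of_subset_of_nonneg (Finset.subset_univ _)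
        fun _ _ _ => sq_nonneg _

/-- The relative error at a parameter whose signal satisfies `‖θ‖² ≤ 4`, in terms of the
probabilities of missing `θ` on the blocks. The loss `a² / 4` per block becomes `a² / 16` after
division by `‖θ‖²`. -/
theorem IsEigendecomposition.le_expRelMSE (h : IsEigendecomposition X lam U)
    {κ π : Type*} [Fintype κ] [Fintype π] (e : κ × π ↪ Fin (covRank X)) (a σ : ℝ)
    {est : (Fin n → ℝ) → Fin d → ℝ} (hest : Measurable est) {β : Fin d → ℝ}
    (h0 : 0 < ∑ j, canonicalCoeff lam U β j ^ 2) (h4 : ∑ j, canonicalCoeff lam U β j ^ 2 ≤ 4) :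
    ENNReal.ofReal (∑ b, a ^ 2 / 16 * (1 - (obsLaw X β σ).real
        (nearSet e a (fun y => canonicalCoeff lam U (est y)) (canonicalCoeff lam U β) b)))
      ≤ expRelMSE X est β σ := by
  set t : (Fin n → ℝ) → Fin (covRank X) → ℝ := fun y => canonicalCoeff lam U (est y) with ht
  set θ := canonicalCoeff lam U β with hθ
  have hA : ∀ b, MeasurableSet (nearSet e a t θ b) := fun b =>
    measurableSet_nearSet e a (fun i => (measurable_canonicalCoeff lam U i).comp hest) θ b
  set f : (Fin n → ℝ) → ℝ := fun y =>
    ∑ b, (nearSet e a t θ b)ᶜ.indicator (fun _ => a ^ 2 / 16) y with hf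
  have hint : ∀ b, Integrable ((nearSet e a t θ b)ᶜ.indicator fun _ => a ^ 2 / 16)
      (obsLaw X β σ) := fun b => (integrable_const _).indicator (hA b).compl
  have hf0 : ∀ y, 0 ≤ f y := fun y =>
    Finset.sum_nonneg fun b _ => Set.indicator_nonneg (fun _ _ => by positivity) _
  have hfi : ∫ y, f y ∂(obsLaw X β σ)
      = ∑ b, a ^ 2 / 16 * (1 - (obsLaw X β σ).real (nearSet e a t θ b)) := by
    rw [integral_finsetSum _ fun b _ => hint b]
    refine Finset.sum_congr rfl fun b _ => ?_
    rw [integral_indicator_const _ (hA b).compl, probReal_compl_eq_one_sub (hA b), smul_eq_mul,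
      mul_comm]
  rw [← hfi, ofReal_integral_eq_lintegral_ofReal (integrable_finsetSum _ fun b _ => hint b)
    (ae_of_all _ hf0)]
  refine lintegral_mono fun y => ENNReal.ofReal_le_ofReal ?_
  have h1 := sum_indicator_compl_nearSet_le e a t θ y
  rw [h.mse_eq, h.mse_zero, le_div_iff₀ h0]
  have h2 : f y * 4 = ∑ b, (nearSet e a t θ b)ᶜ.indicator (fun _ => a ^ 2 / 4) y := by
    rw [hf, Finset.sum_mul]
    refine Finset.sum_congr rfl fun b _ => ?_
    by_cases hy : y ∈ (nearSet e a t θ b)ᶜ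
    · simp only [Set.indicator_of_mem hy]
      ring
    · simp only [Set.indicator_of_notMem hy, zero_mul]
  calc f y * ∑ j, θ j ^ 2 ≤ f y * 4 := mul_le_mul_of_nonneg_left h4 (hf0 y)
    _ ≤ _ := h2.trans_le h1

/-- In a single block, at most the fraction `7 / 8` of the selections can be recovered. -/
theorem IsEigendecomposition.sum_obsLaw_nearSet_le (h : IsEigendecomposition X lam U)
    {κ π : Type*} [DecidableEq κ] [Fintype π] [Nonempty π] (e : κ × π ↪ Fin (covRank X))
    {a σ : ℝ} (hn : 0 < n) (hσ : 0 < σ)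
    (hnoise : n * a ^ 2 ≤ σ ^ 2 * (Real.log (Fintype.card π + 1) / 2)) (i₀ : Fin (covRank X))
    {t : (Fin n → ℝ) → Fin (covRank X) → ℝ} (ht : ∀ i, Measurable fun y => t y i)
    {β : (κ → Option π) → Fin d → ℝ}
    (hβ : ∀ ω, canonicalCoeff lam U (β ω) = spikedCoeff a i₀ e ω) (b : κ) (ω : κ → Option π) :
    ∑ c, (obsLaw X (β (Function.update ω b c)) σ).real
        (nearSet e a t (spikedCoeff a i₀ e (Function.update ω b c)) b)
      ≤ 7 / 8 * Fintype.card (Option π) := by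
  have hv : (σ ^ 2).toNNReal ≠ 0 := by simpa using hσ.ne'
  have hN : (2 : ℝ) ≤ Fintype.card (Option π) := by
    rw [Fintype.card_option]
    have : 1 ≤ Fintype.card π := Fintype.card_pos
    exact_mod_cast Nat.succ_le_succ this
  have hδ : ∀ c, ∑ i, ((X *ᵥ β (Function.update ω b c)) i
      - (X *ᵥ β (Function.update ω b none)) i) ^ 2 ≤ n * a ^ 2 := by
    intro c
    have h1 := h.mse_eq (β (Function.update ω b none)) (β (Function.update ω b c))
    rw [hβ, hβ, mse, inv_mul_eq_iff_eq_mul₀ (by positivity)] at h1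
    rw [h1]
    exact mul_le_mul_of_nonneg_left (sum_spikedCoeff_sub_sq_le e ω a i₀ b c) (by positivity)
  refine (sum_pi_gaussianReal_real_le (fun c => X *ᵥ β (Function.update ω b c))
    (X *ᵥ β (Function.update ω b none)) hv
    (fun c => measurableSet_nearSet e a ht _ b)
    (fun c c' hc => disjoint_nearSet e a t b (le_sum_spikedCoeff_sub_sq e ω a i₀ b hc)) hδ).trans ?_
  refine le_trans ?_ (sqrt_mul_exp_log_div_four_le hN)
  refine mul_le_mul_of_nonneg_left (Real.exp_le_exp.2 ?_) (Real.sqrt_nonneg _)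
  rw [Real.coe_toNNReal _ (sq_nonneg σ), div_le_iff₀ (by positivity), Fintype.card_option]
  push_cast
  linarith

/-- The general minimax bound: `m` blocks of coordinates, in each of which an estimator has to
find out whether and where there is a spike of height `a`. -/
theorem IsEigendecomposition.le_minimaxRelMSE (h : IsEigendecomposition X lam U)
    {κ π : Type*} [Fintype κ] [Fintype π] [Nonempty π] (e : κ × π ↪ Fin (covRank X))
    (i₀ : Fin (covRank X)) {a σ q D S : ℝ} (hn : 0 < n) (ha : 0 ≤ a) (hσ : 0 < σ)
    (hS0 : 0 < S) (hS : S * σ ≤ 1) (hma : Fintype.card κ * a ^ 2 ≤ 1)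
    (hnoise : n * a ^ 2 ≤ σ ^ 2 * (Real.log (Fintype.card π + 1) / 2)) (hq : 0 ≤ q)
    (hD : ∀ ω, lqPow q (spikedCoeff a i₀ e ω) ≤ D) :
    ENNReal.ofReal (Fintype.card κ * a ^ 2 / 128) ≤ minimaxRelMSE X lam U q D S := by
  classical
  choose β hβ using fun ω => h.exists_canonicalCoeff_eq (spikedCoeff a i₀ e ω)
  have hβ1 : ∀ ω, 1 ≤ ∑ j, canonicalCoeff lam U (β ω) j ^ 2 := fun ω => by
    rw [hβ]
    exact one_le_sum_spikedCoeff_sq e ω ha i₀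
  have hβ4 : ∀ ω, ∑ j, canonicalCoeff lam U (β ω) j ^ 2 ≤ 4 := fun ω => by
    rw [hβ]
    exact sum_spikedCoeff_sq_le e ω i₀ hma
  have hmem : ∀ ω, (β ω, σ) ∈ paramClass X lam U q D S := by
    intro ω
    refine ⟨hσ, ?_, ?_⟩
    · have hden : 1 ≤ Real.sqrt (∑ j, canonicalCoeff lam U (β ω) j ^ 2) ^ q :=
        Real.one_le_rpow (Real.one_le_sqrt.2 (hβ1 ω)) hq
      refine (div_le_self ?_ hden).trans ((hβ ω).symm ▸ hD ω)
      unfold lqPow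
      split_ifs
      · positivity
      · exact Finset.sum_nonneg fun _ _ => Real.rpow_nonneg (abs_nonneg _) _
    · rw [h.snr_eq]
      refine Real.le_sqrt_of_sq_le ?_
      rw [le_div_iff₀ (by positivity)]
      calc S ^ 2 * σ ^ 2 = (S * σ) ^ 2 := by ring
        _ ≤ 1 := pow_le_one₀ (by positivity) hS
        _ ≤ _ := hβ1 ω
  refine le_iInf₂ fun est hest => ?_
  set t : (Fin n → ℝ) → Fin (covRank X) → ℝ := fun y => canonicalCoeff lam U (est y) with ht
  have htm : ∀ i, Measurable fun y => t y i := fun i =>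
    (measurable_canonicalCoeff lam U i).comp hest
  set F : κ → (κ → Option π) → ℝ := fun b ω =>
    (obsLaw X (β ω) σ).real (nearSet e a t (spikedCoeff a i₀ e ω) b) with hF
  have hFb : ∀ b, ∑ ω, F b ω ≤ 7 / 8 * Fintype.card (κ → Option π) := by
    intro b
    have hN : (0 : ℝ) < Fintype.card (Option π) := by exact_mod_cast Fintype.card_pos
    have h1 := sum_sum_update_eq b (F b)
    have h2 : ∑ ω, ∑ c, F b (Function.update ω b c)
        ≤ ∑ _ω : κ → Option π, 7 / 8 * (Fintype.card (Option π) : ℝ) :=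
      Finset.sum_le_sum fun ω _ => h.sum_obsLaw_nearSet_le e hn hσ hnoise i₀ htm hβ b ω
    rw [h1, Finset.sum_const, Finset.card_univ, nsmul_eq_mul] at h2
    refine le_of_mul_le_mul_left ?_ hN
    linarith
  -- The average over `ω` of the lower bounds for the risk is at least `m a² / 128`.
  obtain ⟨ω, -, hω⟩ : ∃ ω ∈ (Finset.univ : Finset (κ → Option π)),
      Fintype.card κ * a ^ 2 / 128 ≤ ∑ b, a ^ 2 / 16 * (1 - F b ω) := by
    refine Finset.exists_le_of_sum_le Finset.univ_nonempty ?_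
    rw [Finset.sum_comm]
    calc ∑ _ω : κ → Option π, (Fintype.card κ : ℝ) * a ^ 2 / 128
        = ∑ _b : κ, a ^ 2 / 16 * (1 / 8 * Fintype.card (κ → Option π)) := by
          simp only [Finset.sum_const, Finset.card_univ, nsmul_eq_mul]
          ring
      _ ≤ ∑ b, ∑ ω, a ^ 2 / 16 * (1 - F b ω) := by
          refine Finset.sum_le_sum fun b _ => ?_
          rw [← Finset.mul_sum, Finset.sum_sub_distrib]
          refine mul_le_mul_of_nonneg_left ?_ (by positivity)
          have := hFb b
          simp only [Finset.sum_const, Finset.card_univ, nsmul_eq_mul, mul_one]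
          linarith
  have hle := h.le_expRelMSE e a σ hest (lt_of_lt_of_le one_pos (hβ1 ω)) (hβ4 ω)
  rw [hβ] at hle
  exact (ENNReal.ofReal_le_ofReal hω).trans (hle.trans
    (le_iSup₂_of_le (f := fun p (_ : p ∈ paramClass X lam U q D S) => expRelMSE X est p.1 p.2)
      (β ω, σ) (hmem ω) le_rfl))

/-! ### The two rates -/

/-- Blocks of length one with spikes of the order of the noise level; there are as many blocks as
the `ℓ_q` constraint and the rank allow. -/
theorem IsEigendecomposition.le_minimaxRelMSE_of_pos (h : IsEigendecomposition X lam U)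
    (hX : X ≠ 0) {q D S : ℝ} (hq : 0 < q) (hq2 : q < 2) (hD : 5 ≤ D) (hS : 0 < S) :
    ENNReal.ofReal (1 / 1024 * min 1 (min (1 / (S ^ 2 * (n : ℝ)) ^ (1 - q / 2))
      ((covRank X : ℝ) / (S ^ 2 * (n : ℝ))))) ≤ minimaxRelMSE X lam U q D S := by
  have hn := pos_of_design_ne_zero hX
  have hr := covRank_pos hX
  have hn' : (0 : ℝ) < n := by exact_mod_cast hn
  have hr1 : (1 : ℝ) ≤ covRank X := by exact_mod_cast hr
  set T : ℝ := S ^ 2 * n with hT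
  have hT0 : 0 < T := by positivity
  -- For `T < 1`, the noise level is decreased so that `T` becomes `1`.
  set T' : ℝ := max T 1 with hT'
  have hTT' : T ≤ T' := le_max_left _ _
  have hT1 : 1 ≤ T' := le_max_right _ _
  have hT'0 : 0 < T' := by linarith
  set m : ℕ := min (covRank X) ⌊T' ^ (q / 2)⌋₊ with hm
  have hmT : (m : ℝ) ≤ T' ^ (q / 2) :=
    le_trans (by exact_mod_cast min_le_right _ _) (Nat.floor_le (by positivity))
  have hpow : T' ^ (q / 2) ≤ T' := by
    simpa using Real.rpow_le_rpow_of_exponent_le hT1 (show q / 2 ≤ 1 by linarith)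
  set a : ℝ := Real.sqrt (1 / (4 * T')) with ha
  have ha2 : a ^ 2 = 1 / (4 * T') := Real.sq_sqrt (by positivity)
  have ha0 : 0 ≤ a := Real.sqrt_nonneg _
  have ha1 : a ≤ 1 := by
    refine (sq_le_one_iff₀ ha0).1 ?_
    rw [ha2, div_le_one (by positivity)]
    linarith
  have haq : m * a ^ q ≤ 1 := by
    have h1 : a ^ q ≤ (T' ^ (q / 2))⁻¹ := by
      rw [← Real.inv_rpow hT'0.le, show a ^ q = (a ^ 2) ^ (q / 2) by
        rw [← Real.rpow_natCast, ← Real.rpow_mul ha0]; congr 1; push_cast; ring, ha2]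
      refine Real.rpow_le_rpow (by positivity) ?_ (by positivity)
      rw [← one_div]
      exact one_div_le_one_div_of_le hT'0 (by linarith)
    calc m * a ^ q ≤ T' ^ (q / 2) * (T' ^ (q / 2))⁻¹ := by gcongr
      _ = 1 := mul_inv_cancel₀ (by positivity)
  have hlog : 1 / 2 ≤ Real.log 2 := by linarith [Real.log_two_gt_d9]
  set σ : ℝ := Real.sqrt (n / T') with hσ
  have hσ2 : σ ^ 2 = n / T' := Real.sq_sqrt (by positivity)
  have hσ0 : 0 < σ := Real.sqrt_pos.2 (by positivity)
  let e : Fin m × Fin 1 ↪ Fin (covRank X) :=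
    finProdFinEquiv.toEmbedding.trans (Fin.castLEEmb (by rw [mul_one]; exact min_le_left _ _))
  have main := h.le_minimaxRelMSE e ⟨0, hr⟩ (a := a) (σ := σ) (q := q) (D := D) hn ha0 hσ0 hS
    (by
      refine (sq_le_one_iff₀ (by positivity)).1 ?_
      rw [mul_pow, hσ2, ← mul_div_assoc, div_le_one hT'0]
      exact hTT')
    (by
      rw [Fintype.card_fin, ha2, mul_one_div, div_le_one (by positivity)]
      linarith)
    (by
      rw [Fintype.card_fin, ha2, hσ2, Nat.cast_one, one_add_one_eq_two, mul_one_div,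
        div_mul_eq_mul_div, div_le_div_iff₀ (by positivity) hT'0]
      have := mul_pos hn' hT'0
      nlinarith)
    hq.le
    (fun ω => by
      refine (lqPow_spikedCoeff_le e ω ha0 ha1 _ hq hq2.le).trans ?_
      rw [Fintype.card_fin]
      linarith)
  refine le_trans (ENNReal.ofReal_le_ofReal ?_) main
  rw [Fintype.card_fin, ha2]
  have h2 : min (1 / T' ^ (1 - q / 2)) ((covRank X : ℝ) / T') ≤ 2 * m / T' := by
    rcases min_choice (covRank X) ⌊T' ^ (q / 2)⌋₊ with hc | hc
    · refine (min_le_right _ _).trans ?_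
      rw [← hm] at hc
      rw [hc]
      gcongr
      linarith
    · refine (min_le_left _ _).trans ?_
      rw [← hm] at hc
      have h1 : 1 ≤ T' ^ (q / 2) := Real.one_le_rpow hT1 (by positivity)
      have hm1 : (1 : ℝ) ≤ m := by
        rw [hc]
        exact_mod_cast Nat.one_le_floor_iff _ |>.2 h1
      have hm2 : T' ^ (q / 2) ≤ 2 * m := by
        have := Nat.lt_floor_add_one (T' ^ (q / 2))
        rw [← hc] at this
        linarith
      rw [Real.rpow_sub hT'0, Real.rpow_one, one_div_div]
      gcongr
  have h3 : min 1 (min (1 / T ^ (1 - q / 2)) ((covRank X : ℝ) / T))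
      ≤ min (1 / T' ^ (1 - q / 2)) ((covRank X : ℝ) / T') := by
    rcases le_total 1 T with h1 | h1
    · rw [hT', max_eq_left h1]
      exact min_le_right _ _
    · rw [hT', max_eq_right h1]
      refine (min_le_left _ _).trans (le_min (by simp) (by simpa using hr1))
  calc _ ≤ 1 / 1024 * (2 * m / T') := mul_le_mul_of_nonneg_left (h3.trans h2) (by norm_num)
    _ = m * (1 / (4 * T')) / 128 := by
      field_simp
      ring

/-- Splitting `r` coordinates into `⌊D⌋ - 1` blocks (at most `r`) of equal length loses only a
constant in the rate `D log (e r / D)`. -/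
theorem mul_log_le_of_blocks {r m : ℕ} {D : ℝ} (hr : 0 < r) (hD : 2 ≤ D)
    (hm : m = min (⌊D⌋₊ - 1) r) :
    D * Real.log (Real.exp 1 * r / D) ≤ 8 * m * Real.log ((r / m : ℕ) + 1) := by
  have hk : 2 ≤ ⌊D⌋₊ := Nat.le_floor (by exact_mod_cast hD)
  have hm1 : 0 < m := by omega
  have hm0 : (0 : ℝ) < m := by exact_mod_cast hm1
  have hr0 : (0 : ℝ) < r := by exact_mod_cast hr
  have hD0 : 0 < D := by linarith
  have hB : 1 ≤ r / m := (Nat.one_le_div_iff hm1).2 (hm ▸ min_le_right _ _)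
  have hL : 0.69 ≤ Real.log ((r / m : ℕ) + 1) := by
    refine le_trans (by linarith [Real.log_two_gt_d9]) (Real.log_le_log two_pos ?_)
    exact_mod_cast Nat.succ_le_succ hB
  set L := Real.log ((r / m : ℕ) + 1) with hLdef
  have hlog : Real.log (Real.exp 1 * r / D) = 1 + Real.log (r / D) := by
    rw [mul_div_assoc, Real.log_mul (Real.exp_ne_zero _) (by positivity), Real.log_exp]
  rw [hlog]
  rcases le_total r (⌊D⌋₊ - 1) with hc | hc
  · have hmr : m = r := by omega
    have h1 : Real.log (r / D) ≤ r / D - 1 := Real.log_le_sub_one_of_pos (by positivity)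
    calc D * (1 + Real.log (r / D)) ≤ D * (r / D) := by gcongr; linarith
      _ = m := by rw [hmr]; field_simp
      _ ≤ _ := by nlinarith
  · have hmk : m + 1 = ⌊D⌋₊ := by omega
    have hmD : (m : ℝ) + 1 ≤ D := by
      have := Nat.floor_le hD0.le
      rw [← hmk] at this
      exact_mod_cast this
    have hDm : D ≤ 3 * m := by
      have h1 := Nat.lt_floor_add_one D
      rw [← hmk] at h1
      have h2 : (1 : ℝ) ≤ m := by exact_mod_cast hm1
      push_cast at h1
      linarith
    have hlt : (r : ℝ) ≤ m * ((r / m : ℕ) + 1) := by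
      exact_mod_cast (Nat.lt_mul_div_succ r hm1).le
    have h1 : Real.log (r / D) ≤ L := by
      refine Real.log_le_log (by positivity) ?_
      rw [div_le_iff₀ hD0, mul_comm]
      refine hlt.trans ?_
      gcongr
      linarith
    calc D * (1 + Real.log (r / D)) ≤ 3 * m * (2.5 * L) := by
          have h2 : 1 + Real.log (r / D) ≤ 2.5 * L := by linarith
          have h3 : 0 ≤ 2.5 * L := by linarith
          exact (mul_le_mul_of_nonneg_left h2 hD0.le).trans (mul_le_mul_of_nonneg_right hDm h3)
      _ ≤ _ := by nlinarith

/-- For exact sparsity, `⌊D⌋ - 1` blocks (at most `r`) that are as long as possible. The noise hides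
spikes above its level by a factor of the order of the square root of the logarithm of the block
length; their height is capped so that the signals remain bounded. -/
theorem IsEigendecomposition.le_minimaxRelMSE_zero (h : IsEigendecomposition X lam U)
    (hX : X ≠ 0) {D S : ℝ} (hD : 2 ≤ D) (hS : 0 < S) :
    ENNReal.ofReal (1 / 2048 * min 1 (D * Real.log (Real.exp 1 * (covRank X : ℝ) / D)
      / (S ^ 2 * (n : ℝ)))) ≤ minimaxRelMSE X lam U 0 D S := by
  have hn := pos_of_design_ne_zero hX
  have hr := covRank_pos hX
  have hn' : (0 : ℝ) < n := by exact_mod_cast hn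
  have hk : 2 ≤ ⌊D⌋₊ := Nat.le_floor (by exact_mod_cast hD)
  obtain ⟨m, hm⟩ : ∃ m, m = min (⌊D⌋₊ - 1) (covRank X) := ⟨_, rfl⟩
  have hm1 : 0 < m := by omega
  have hm0 : (0 : ℝ) < m := by exact_mod_cast hm1
  have hmD : 1 + (m : ℝ) ≤ D := by
    have h1 : 1 + m ≤ ⌊D⌋₊ := by omega
    exact le_trans (by exact_mod_cast h1) (Nat.floor_le (by linarith))
  have hkey := mul_log_le_of_blocks hr hD hm
  have hB : 0 < covRank X / m := Nat.div_pos (by omega) hm1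
  obtain ⟨B, hBdef⟩ : ∃ B, B = covRank X / m := ⟨_, rfl⟩
  rw [← hBdef] at hB hkey
  set L := Real.log ((B : ℝ) + 1) with hL
  have hL0 : 0 ≤ L := Real.log_nonneg (by linarith [(Nat.cast_nonneg B : (0 : ℝ) ≤ B)])
  set T : ℝ := S ^ 2 * n with hT
  have hT0 : 0 < T := by positivity
  set a : ℝ := Real.sqrt (min (1 / (m : ℝ)) (L / (2 * T))) with ha
  have ha2 : a ^ 2 = min (1 / (m : ℝ)) (L / (2 * T)) := Real.sq_sqrt (by positivity)
  have ha0 : 0 ≤ a := Real.sqrt_nonneg _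
  have hma : m * a ^ 2 = min 1 (m * L / (2 * T)) := by
    rw [ha2, mul_min_of_nonneg _ _ hm0.le, mul_one_div_cancel hm0.ne', mul_div_assoc]
  have : Nonempty (Fin B) := ⟨⟨0, hB⟩⟩
  let e : Fin m × Fin B ↪ Fin (covRank X) := finProdFinEquiv.toEmbedding.trans
    (Fin.castLEEmb (by rw [hBdef]; exact Nat.mul_div_le _ _))
  have main := h.le_minimaxRelMSE e ⟨0, hr⟩ (a := a) (σ := 1 / S) (q := 0) (D := D) hn ha0
    (by positivity) hS (mul_one_div_cancel hS.ne').le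
    (by
      rw [Fintype.card_fin, hma]
      exact min_le_left _ _)
    (by
      rw [Fintype.card_fin, ha2]
      calc (n : ℝ) * min (1 / (m : ℝ)) (L / (2 * T)) ≤ n * (L / (2 * T)) := by
            gcongr
            exact min_le_right _ _
        _ = (1 / S) ^ 2 * (L / 2) := by
            rw [hT]
            field_simp)
    le_rfl
    (fun ω => by
      refine (lqPow_zero_spikedCoeff_le e ω a _).trans ?_
      rwa [Fintype.card_fin])
  refine le_trans (ENNReal.ofReal_le_ofReal ?_) main
  rw [Fintype.card_fin, hma]
  have h1 : D * Real.log (Real.exp 1 * (covRank X : ℝ) / D) / T ≤ 16 * (m * L / (2 * T)) := by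
    rw [div_le_iff₀ hT0]
    calc _ ≤ 8 * m * L := hkey
      _ = _ := by
        field_simp
        ring
  have h2 : min 1 (D * Real.log (Real.exp 1 * (covRank X : ℝ) / D) / T)
      ≤ 16 * min 1 (m * L / (2 * T)) := by
    rw [mul_min_of_nonneg _ _ (by norm_num)]
    exact min_le_min (by norm_num) h1
  linarith

end

end CanonicalRegression

theorem theorem3 :
    (∃ D₀ c : ℝ, 0 < c ∧
      ∀ q : ℝ, 0 < q → q < 2 →
      ∀ (n d : ℕ) (X : Matrix (Fin n) (Fin d) ℝ), X ≠ 0 →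
      ∀ (lam : Fin (CanonicalRegression.covRank X) → ℝ)
        (U : Matrix (Fin d) (Fin (CanonicalRegression.covRank X)) ℝ),
        CanonicalRegression.IsEigendecomposition X lam U →
      ∀ D S : ℝ, D₀ ≤ D → 0 < S →
        ENNReal.ofReal
            (c * min 1 (min (1 / (S ^ 2 * (n : ℝ)) ^ (1 - q / 2))
              ((CanonicalRegression.covRank X : ℝ) / (S ^ 2 * (n : ℝ)))))
          ≤ CanonicalRegression.minimaxRelMSE X lam U q D S) ∧
    (∃ c : ℝ, 0 < c ∧
      ∀ (n d : ℕ) (X : Matrix (Fin n) (Fin d) ℝ), X ≠ 0 →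
      ∀ (lam : Fin (CanonicalRegression.covRank X) → ℝ)
        (U : Matrix (Fin d) (Fin (CanonicalRegression.covRank X)) ℝ),
        CanonicalRegression.IsEigendecomposition X lam U →
      ∀ D S : ℝ, 2 ≤ D → 0 < S →
        ENNReal.ofReal
            (c * min 1 (D * Real.log (Real.exp 1 * (CanonicalRegression.covRank X : ℝ) / D)
              / (S ^ 2 * (n : ℝ))))
          ≤ CanonicalRegression.minimaxRelMSE X lam U 0 D S) := by
  refine ⟨⟨5, 1 / 1024, by norm_num, ?_⟩, ⟨1 / 2048, by norm_num, ?_⟩⟩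
  · intro q hq hq2 n d X hX lam U h D S hD hS
    exact h.le_minimaxRelMSE_of_pos hX hq hq2 hD hS
  · intro n d X hX lam U h D S hD hS
    exact h.le_minimaxRelMSE_zero hX hD hS
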